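/- Consider the following model of a random ad hoc network with $n$ nodes on the sphere $S^2$ of unit area (all distances $d$ are measured along the surface). The nodes have independent uniform positions $X_1,\dots,X_n$, and every node picks as its destination, independently of everything else, another node uniformly at random. Time is slotted, one slot being the transmission time of one packet. (A1) $S^2$ is divided by a Voronoi tessellation each cell of which contains a disk of radius $\rho_n$ and is contained in a disk of radius $2\rho_n$, where $\rho_n\to 0$ and, for some constant $a>0$, $\rho_n\ge a\sqrt{\log n/n}$ for all large $n$. All nodes transmit with the same power $P>0$. (A2) If the nodes of a set $T$ transmit simultaneously, a transmission from $u\in T$ to $v$ has $$\mathrm{SINR}=\frac{P\,d(X_u,X_v)^{-\alpha}}{N+\sum_{k\in T\setminus\{u\}}P\,d(X_k,X_v)^{-\alpha}},\qquad \alpha>2,$$ where $N\ge 0$ is the noise power, and it succeeds with probability $\phi(\mathrm{SINR})$, where $\phi$ is a fixed continuous nondecreasing function with $\phi(s)<1$ for every finite $s$ and $\phi(s)\to1$ as $s\to\infty$. Losses on different hops are independent, and there are no retransmissions. (A3) Transmissions follow a periodic schedule whose period is at most a constant $K$ independent of $n$, in which every cell gets at least one transmission opportunity per period. In every slot exactly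 one node of each scheduled nonempty cell transmits, and no other node transmits. (A4) A packet is routed along the straight line (minimal geodesic) from its source to its destination: it is handed from cell to cell in order along this line, every cell that meets the line takes part, and each cell forwards it at most once, through any of its nodes. All nodes inject their own packets at a common rate of $\lambda_n$ packets per slot. The schedule, the relays and $\lambda_n$ may depend on the positions and destinations. Let $\Lambda_n(i)$ be the resulting end-to-end throughput of connection $i$, that is, the long-run mean number of its packets per slot that survive all their hops (which is $\lambda_n$ times the product of the success probabilities of the hops if this product is the same for all packets), and let $\mathbf E[\Lambda_n(i)]$ be its expectation over positions and destinations. Then the achievable per-node throughput is $O(1/n)$ for every choice of $\rho_n$ as in (A1): there is a constant $c$, depending only on $\alpha$, $\phi$ and $K$, such that for every such $(\rho_n)$ and all sufficiently large $n$, $\mathbf E[\Lambda_n(i)]\le c/n$ for every node $i$, every tessellation as in (A1), all $P>0$ and $N\ge0$, and every mode of operation that satisfies (A2)-(A4). -/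

import Mathlib

open scoped ENNReal NNReal

namespace AdHoc

noncomputable section

/-- The sphere of unit area (radius `1 / (2 √π)`), a point being recorded by its direction from the
centre; lengths and areas are rescaled accordingly below. -/
abbrev Sph : Type := Metric.sphere (0 : EuclideanSpace ℝ (Fin 3)) 1

/-- Distance along the surface of the sphere of unit area. -/
def geoDist (x y : Sph) : ℝ :=
  InnerProductGeometry.angle (x : EuclideanSpace ℝ (Fin 3)) (y : EuclideanSpace ℝ (Fin 3)) /
    (2 * Real.sqrt Real.pi)

/-- The disk of radius `r` around `x`, along the surface. -/
def disk (x : Sph) (r : ℝ) : Set Sph := {y | geoDist x y ≤ r}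

/-- The straight line (minimal geodesic) between two points of the sphere. -/
def segment (x y : Sph) : Set Sph := {z | geoDist x z + geoDist z y = geoDist x y}

/-- The area measure on the sphere of unit area, i.e. the uniform distribution. -/
def area : MeasureTheory.Measure Sph :=
  ((MeasureTheory.volume : MeasureTheory.Measure (EuclideanSpace ℝ (Fin 3))).toSphere Set.univ)⁻¹ •
    (MeasureTheory.volume : MeasureTheory.Measure (EuclideanSpace ℝ (Fin 3))).toSphere

instance : MeasureTheory.IsProbabilityMeasure area := by
  refine ⟨?_⟩
  rw [area, MeasureTheory.Measure.smul_apply, smul_eq_mul]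
  refine ENNReal.inv_mul_cancel ?_ (MeasureTheory.measure_ne_top _ _)
  exact MeasureTheory.Measure.measure_univ_ne_zero.2
    (MeasureTheory.Measure.toSphere_ne_zero MeasureTheory.volume)

/-- A Voronoi tessellation of the sphere, each cell of which contains a disk of radius `r` and is
contained in a disk of radius `2 r`. -/
structure Tessellation (r : ℝ) where
  /-- number of cells -/
  count : ℕ
  count_pos : 0 < count
  /-- the generating points -/
  site : Fin count → Sph
  site_injective : Function.Injective site
  inner_disk : ∀ c, ∃ p, disk p r ⊆ {x | ∀ c', geoDist x (site c) ≤ geoDist x (site c')}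
  outer_disk : ∀ c, ∃ p, {x | ∀ c', geoDist x (site c) ≤ geoDist x (site c')} ⊆ disk p (2 * r)

/-- The cell with index `c`. -/
def Tessellation.cell {r : ℝ} (V : Tessellation r) (c : Fin V.count) : Set Sph :=
  {x | ∀ c', geoDist x (V.site c) ≤ geoDist x (V.site c')}

/-- Growth condition on the cell radius: `ρ n = Ω(√(log n / n))` and `ρ n → 0`. -/
structure IsCellRadius (ρ : ℕ → ℝ) : Prop where
  lower : ∃ a : ℝ, 0 < a ∧ ∀ᶠ n : ℕ in Filter.atTop, a * Real.sqrt (Real.log n / n) ≤ ρ n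
  tendsto_zero : Filter.Tendsto ρ Filter.atTop (nhds 0)

/-- Packet success probability as a function of the SINR: continuous, increasing, tending to one as
the SINR tends to infinity (continuity at `∞`, where the value is one), and less than one at every
finite SINR. -/
structure IsLinkModel (φ : ℝ≥0∞ → ℝ≥0∞) : Prop where
  continuous : Continuous φ
  monotone : Monotone φ
  top : φ ∞ = 1
  lt_one : ∀ s : ℝ≥0∞, s ≠ ∞ → φ s < 1

/-- Power received over distance `geoDist x y`, at transmit power `P` and path loss exponent `α`.
It is infinite at distance zero, so a node that is itself transmitting hears nothing else. -/
def receivedPower (α : ℝ) (P : ℝ≥0) (x y : Sph) : ℝ≥0∞ :=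
  (P : ℝ≥0∞) / ENNReal.ofReal (geoDist x y) ^ α

/-- SINR of the transmission from `u` to `v` when the nodes of `T` transmit simultaneously, with
noise power `N`. -/
def sinr {n : ℕ} (α : ℝ) (P N : ℝ≥0) (x : Fin n → Sph) (T : Finset (Fin n)) (u v : Fin n) : ℝ≥0∞ :=
  receivedPower α P (x u) (x v) / ((N : ℝ≥0∞) + ∑ k ∈ T.erase u, receivedPower α P (x k) (x v))

/-- A periodic schedule of length at most `K`: `active t` is the set of cells that get a
transmission opportunity in slot `t`; every cell gets at least one per period. -/
structure Schedule (Cell : Type) (K : ℕ) where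
  period : ℕ
  period_pos : 0 < period
  period_le : period ≤ K
  active : ℕ → Set Cell
  periodic : ∀ t, active (t + period) = active t
  covers : ∀ c, ∃ t, c ∈ active t

/-- The way of a packet through the network: hop `j < hops` goes from `node j` to `node (j + 1)`
and takes place in slot `slot j`; each hop is attempted once. -/
structure Trip (n : ℕ) where
  hops : ℕ
  node : ℕ → Fin n
  slot : ℕ → ℕ

/-- Probability that a packet survives all the hops of its trip, `T t` being the set of nodes that
transmit in slot `t`; losses on different hops are independent. -/
def Trip.success {n : ℕ} (φ : ℝ≥0∞ → ℝ≥0∞) (α : ℝ) (P N : ℝ≥0) (x : Fin n → Sph)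
    (T : ℕ → Finset (Fin n)) (q : Trip n) : ℝ≥0∞ :=
  ∏ j ∈ Finset.range q.hops, φ (sinr α P N x (T (q.slot j)) (q.node j) (q.node (j + 1)))

/-- Straight line routing from `i` to `d`: the packet is handed from cell to cell, in order, along
the line joining the two nodes, and every cell that meets this line takes part. Each cell forwards
the packet at most once (through any of its nodes), and the destination may get the packet either
directly from the preceding cell or from a node of its own cell. -/
structure Trip.IsStraight {n : ℕ} {r : ℝ} (V : Tessellation r) (x : Fin n → Sph)
    (home : Fin n → Fin V.count) (i d : Fin n) (q : Trip n) : Prop where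
  hops_pos : 0 < q.hops
  source : q.node 0 = i
  target : q.node q.hops = d
  node_injOn : Set.InjOn q.node (Set.Iic q.hops)
  cell_injOn : Set.InjOn (fun j => home (q.node j)) (Set.Iio q.hops)
  /-- consecutive cells meet at points of the line, which are passed in order -/
  crossing : ∃ p : ℕ → Sph,
    (∀ j < q.hops, p j ∈ segment (x i) (x d) ∧
      p j ∈ V.cell (home (q.node j)) ∧ p j ∈ V.cell (home (q.node (j + 1)))) ∧
    ∀ j, j + 1 < q.hops → geoDist (x i) (p j) ≤ geoDist (x i) (p (j + 1))
  all_cells : ∀ c, (V.cell c ∩ segment (x i) (x d)).Nonempty → ∃ j ≤ q.hops, home (q.node j) = c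

/-- Operation of the network for given node positions `x` and destinations `dest`. -/
structure Operation {n : ℕ} {r : ℝ} (V : Tessellation r) (K : ℕ) (x : Fin n → Sph)
    (dest : Fin n → Fin n) where
  /-- the cell of a node (a choice matters only for a node on the border of two cells) -/
  home : Fin n → Fin V.count
  home_mem : ∀ i, x i ∈ V.cell (home i)
  sched : Schedule (Fin V.count) K
  /-- the nodes that transmit in a given slot -/
  transmits : ℕ → Finset (Fin n)
  /-- only scheduled cells transmit -/
  active_of_transmits : ∀ t, ∀ i ∈ transmits t, home i ∈ sched.active t
  /-- every scheduled cell that has a node uses its opportunity, through exactly one node -/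
  one_per_cell : ∀ t, ∀ c ∈ sched.active t, (∃ i, home i = c) → ∃! i, i ∈ transmits t ∧ home i = c
  /-- the slots in which a node transmits a new packet of its own -/
  injects : Fin n → Set ℕ
  transmits_of_injects : ∀ i, ∀ t ∈ injects i, i ∈ transmits t
  /-- common injection rate of all the nodes, in packets per slot -/
  rate : ℝ
  tendsto_rate : ∀ i, Filter.Tendsto
    (fun s : ℕ => (∑ t ∈ Finset.range s, (injects i).indicator (fun _ => (1 : ℝ)) t) / s)
    Filter.atTop (nhds rate)
  /-- the trip of the packet that node `i` injects in slot `t`; `none` if the packet is certain to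
  be lost (for instance when a cell on its line has no node) -/
  trip : Fin n → ℕ → Option (Trip n)
  straight : ∀ i, ∀ t ∈ injects i, ∀ q, trip i t = some q → q.IsStraight V x home i (dest i)
  first_slot : ∀ i, ∀ t ∈ injects i, ∀ q, trip i t = some q → q.slot 0 = t
  slot_lt : ∀ i, ∀ t ∈ injects i, ∀ q, trip i t = some q →
    ∀ j, j + 1 < q.hops → q.slot j < q.slot (j + 1)
  transmits_hop : ∀ i, ∀ t ∈ injects i, ∀ q, trip i t = some q →
    ∀ j < q.hops, q.node j ∈ transmits (q.slot j)

/-- End-to-end throughput of connection `i`: the long-run mean number of packets of the connection,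
per slot, that reach the destination. -/
def Operation.throughput {n : ℕ} {r : ℝ} {V : Tessellation r} {K : ℕ} {x : Fin n → Sph}
    {dest : Fin n → Fin n} (O : Operation V K x dest) (φ : ℝ≥0∞ → ℝ≥0∞) (α : ℝ) (P N : ℝ≥0)
    (i : Fin n) : ℝ≥0∞ :=
  Filter.limsup (fun s : ℕ => (∑ t ∈ Finset.range s, (O.injects i).indicator
    (fun t => (O.trip i t).elim 0 (Trip.success φ α P N x O.transmits)) t) / (s : ℝ≥0∞))
    Filter.atTop

/-- Positions of the nodes, and for every node another node as its destination. -/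
abbrev Config (n : ℕ) : Type := (Fin n → Sph) × ((i : Fin n) → {j : Fin n // j ≠ i})

/-- The random network: positions are independent and uniform on the sphere; every node picks its
destination uniformly among the other nodes, independently of everything else. -/
def configMeasure (n : ℕ) : MeasureTheory.Measure (Config n) :=
  (MeasureTheory.Measure.pi fun _ : Fin n => area).prod
    (ProbabilityTheory.uniformOn (Set.univ : Set ((i : Fin n) → {j : Fin n // j ≠ i})))

/-- Expected throughput of connection `i` over the random network, when the network is operated
as `S` prescribes for each outcome. -/
def expectedThroughput {n : ℕ} {r : ℝ} {V : Tessellation r} {K : ℕ}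
    (S : (ω : Config n) → Operation V K ω.1 (fun i => (ω.2 i : Fin n)))
    (φ : ℝ≥0∞ → ℝ≥0∞) (α : ℝ) (P N : ℝ≥0) (i : Fin n) : ℝ≥0∞ :=
  ∫⁻ ω, (S ω).throughput φ α P N i ∂(configMeasure n)

end

end AdHoc

/-!
The bound combines two facts of opposite dependence on the cell radius `r`.

* *The injection rate is at most of the order of `1 / (n r²)`.* A cell has at most one transmitting
  node per slot, so that the rates of its nodes add up to at most one, and `n * rate` is at most the
  number of cells (`Operation.mul_rate_le`). As every cell contains a disk of radius `r`, there are
  at most `8 / r²` cells (`Tessellation.count_le`).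
* *The mean survival probability of a packet is at most of the order of `r²`.* It decays
  geometrically in the distance from source to destination, measured in units of `r`
  (`Operation.throughput_le`), and the probability that this distance is less than `R` is at most
  `16 R²` (`configMeasure_dist_lt_le`).

The geometric decay requires a SINR that is bounded on a positive fraction of the hops, which is not
immediate: two nodes on different sides of a border may be arbitrarily close to each other, and
the schedule may isolate some of the cells. But the hops of a route start in different cells, only a
bounded number of which come within distance `r` of a point. So every block of a bounded number of
hops has a long one (`Trip.IsStraight.exists_long_hop`), and `K + 1` such blocks have two long hops
in the same phase of the schedule. In the slot of the earlier one, the cell of the later one is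
scheduled too, and some node of it transmits at a distance of the order of `r`
(`Operation.exists_sinr_le`). In this way the interference comes from the cells of the route itself,
which are known to be nonempty, and no estimate of the occupancy of the cells is needed.

Disks are packed by comparing volumes of balls of `ℝ³` (`sum_radius_cube_le`). For this reason the
estimates use the chordal distance, which is `dist` on `Sph` and lies between two and four times
`geoDist`.
-/

namespace AdHoc

open MeasureTheory Metric
open scoped Pointwise

/-! ### Chordal distance and packing -/

lemma inner_eq_cos_angle (x y : Sph) :
    inner ℝ (x : EuclideanSpace ℝ (Fin 3)) (y : EuclideanSpace ℝ (Fin 3)) =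
      Real.cos (InnerProductGeometry.angle (x : EuclideanSpace ℝ (Fin 3))
        (y : EuclideanSpace ℝ (Fin 3))) := by
  rw [InnerProductGeometry.cos_angle, norm_eq_of_mem_sphere x, norm_eq_of_mem_sphere y]
  simp

lemma dist_sq_eq (x y : Sph) :
    dist x y ^ 2 = 2 - 2 * Real.cos (InnerProductGeometry.angle
      (x : EuclideanSpace ℝ (Fin 3)) (y : EuclideanSpace ℝ (Fin 3))) := by
  rw [Subtype.dist_eq, dist_eq_norm, norm_sub_sq_real, norm_eq_of_mem_sphere x,
    norm_eq_of_mem_sphere y, inner_eq_cos_angle]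
  ring

lemma angle_eq_mul_geoDist (x y : Sph) :
    InnerProductGeometry.angle (x : EuclideanSpace ℝ (Fin 3)) (y : EuclideanSpace ℝ (Fin 3)) =
      2 * Real.sqrt Real.pi * geoDist x y := by
  have : Real.sqrt Real.pi ≠ 0 := (Real.sqrt_pos.2 Real.pi_pos).ne'
  rw [geoDist]
  field_simp

lemma geoDist_nonneg (x y : Sph) : 0 ≤ geoDist x y :=
  div_nonneg (InnerProductGeometry.angle_nonneg _ _) (by positivity)

lemma geoDist_comm (x y : Sph) : geoDist x y = geoDist y x := by
  rw [geoDist, geoDist, InnerProductGeometry.angle_comm]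

lemma two_mul_geoDist_le_dist (x y : Sph) : 2 * geoDist x y ≤ dist x y := by
  refine le_of_sq_le_sq ?_ dist_nonneg
  have hπ := Real.pi_pos
  have h := Real.cos_le_one_sub_mul_cos_sq (x := InnerProductGeometry.angle
    (x : EuclideanSpace ℝ (Fin 3)) (y : EuclideanSpace ℝ (Fin 3)))
    (by rw [abs_of_nonneg (InnerProductGeometry.angle_nonneg _ _)]
        exact InnerProductGeometry.angle_le_pi _ _)
  rw [dist_sq_eq]
  rw [angle_eq_mul_geoDist] at h ⊢
  have h2 : 2 / Real.pi ^ 2 * (2 * √Real.pi * geoDist x y) ^ 2 = 8 / Real.pi * geoDist x y ^ 2 := by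
    rw [mul_pow, mul_pow, Real.sq_sqrt hπ.le]
    field_simp
    ring
  have h3 : 2 ≤ 8 / Real.pi := by
    rw [le_div_iff₀ hπ]
    linarith [Real.pi_le_four]
  nlinarith [sq_nonneg (geoDist x y)]

lemma dist_le_four_mul_geoDist (x y : Sph) : dist x y ≤ 4 * geoDist x y := by
  refine le_of_sq_le_sq ?_ (mul_nonneg (by norm_num) (geoDist_nonneg x y))
  have h := Real.one_sub_sq_div_two_le_cos (x := InnerProductGeometry.angle
    (x : EuclideanSpace ℝ (Fin 3)) (y : EuclideanSpace ℝ (Fin 3)))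
  rw [dist_sq_eq]
  rw [angle_eq_mul_geoDist] at h ⊢
  rw [mul_pow, mul_pow, Real.sq_sqrt Real.pi_pos.le] at h
  nlinarith [sq_nonneg (geoDist x y), Real.pi_le_four]

/-- Disjoint balls inside a ball of radius `R` have at most its total volume. -/
lemma sum_radius_cube_le {ι : Type*} (s : Finset ι) (p : ι → EuclideanSpace ℝ (Fin 3)) (r : ι → ℝ)
    (z : EuclideanSpace ℝ (Fin 3)) {R : ℝ} (hr : ∀ i ∈ s, 0 ≤ r i) (hR : 0 ≤ R)
    (hsep : ∀ i ∈ s, ∀ j ∈ s, i ≠ j → r i + r j ≤ dist (p i) (p j))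
    (hin : ∀ i ∈ s, dist (p i) z + r i ≤ R) :
    ∑ i ∈ s, r i ^ 3 ≤ R ^ 3 := by
  have hvol : ∀ (c : EuclideanSpace ℝ (Fin 3)) {t : ℝ}, 0 ≤ t →
      volume.real (ball c t) =
        t ^ 3 * volume.real (ball (0 : EuclideanSpace ℝ (Fin 3)) 1) := by
    intro c t ht
    rw [measureReal_def, Measure.addHaar_ball volume c ht, ENNReal.toReal_mul,
      ENNReal.toReal_ofReal (by positivity), ← measureReal_def, finrank_euclideanSpace_fin]
  have hunit : 0 < volume.real (ball (0 : EuclideanSpace ℝ (Fin 3)) 1) :=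
    ENNReal.toReal_pos (measure_ball_pos volume _ one_pos).ne' measure_ball_lt_top.ne
  refine le_of_mul_le_mul_right ?_ hunit
  rw [← hvol z hR, Finset.sum_mul]
  calc ∑ i ∈ s, r i ^ 3 * volume.real (ball (0 : EuclideanSpace ℝ (Fin 3)) 1)
      = ∑ i ∈ s, volume.real (ball (p i) (r i)) :=
        Finset.sum_congr rfl fun i hi => (hvol _ (hr i hi)).symm
    _ = volume.real (⋃ i ∈ s, ball (p i) (r i)) :=
        (measureReal_biUnion_finset
          (fun i hi j hj hij => ball_disjoint_ball (hsep i hi j hj hij))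
          (fun i _ => measurableSet_ball) (fun i _ => measure_ball_lt_top.ne)).symm
    _ ≤ volume.real (ball z R) :=
        measureReal_mono (Set.iUnion₂_subset fun i hi => ball_subset_ball' (by
          linarith [hin i hi])) measure_ball_lt_top.ne

/-! ### Area of small caps -/

/-- The cone over a cap of radius `R` is covered by balls of radius `2 R` centred at the points
`k R x`, `k ≤ 1 / R`, of its axis. -/
lemma area_ball_le (x : Sph) {R : ℝ} (hR : 0 < R) :
    area (ball x R) ≤ ENNReal.ofReal (16 * R ^ 2) := by
  rcases le_total 1 R with h1 | h1
  -- The bound exceeds the total area.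
  · refine prob_le_one.trans ?_
    rw [ENNReal.one_le_ofReal]
    nlinarith
  set B : ℝ≥0∞ := volume (ball (0 : EuclideanSpace ℝ (Fin 3)) 1) with hB
  have hB0 : B ≠ 0 := (measure_ball_pos volume _ one_pos).ne'
  have hBt : B ≠ ∞ := measure_ball_lt_top.ne
  set m : ℕ := ⌊1 / R⌋₊ with hm
  have hcover : Set.Ioo (0 : ℝ) 1 • ((↑) '' ball x R : Set (EuclideanSpace ℝ (Fin 3))) ⊆
      ⋃ k ∈ Finset.range (m + 1), ball (((k : ℝ) * R) • (x : EuclideanSpace ℝ (Fin 3))) (2 * R) := by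
    rintro _ ⟨t, ht, _, ⟨y, hy, rfl⟩, rfl⟩
    simp only [Set.mem_iUnion, Finset.mem_range, exists_prop]
    have htR : 0 ≤ t / R := div_nonneg ht.1.le hR.le
    refine ⟨⌊t / R⌋₊, Nat.lt_succ_of_le (Nat.floor_mono (by gcongr; exact ht.2.le)), ?_⟩
    have hf1 := Nat.floor_le htR
    have hf2 := Nat.lt_floor_add_one (t / R)
    rw [le_div_iff₀ hR] at hf1
    rw [div_lt_iff₀ hR] at hf2
    have e1 : dist (t • (y : EuclideanSpace ℝ (Fin 3))) (t • (x : EuclideanSpace ℝ (Fin 3))) < R := by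
      rw [dist_smul₀, Real.norm_of_nonneg ht.1.le]
      have : dist (y : EuclideanSpace ℝ (Fin 3)) (x : EuclideanSpace ℝ (Fin 3)) < R := hy
      nlinarith [ht.1, ht.2, dist_nonneg (x := (y : EuclideanSpace ℝ (Fin 3)))
        (y := (x : EuclideanSpace ℝ (Fin 3)))]
    have e2 : dist (t • (x : EuclideanSpace ℝ (Fin 3)))
        (((⌊t / R⌋₊ : ℝ) * R) • (x : EuclideanSpace ℝ (Fin 3))) ≤ R := by
      rw [dist_eq_norm, ← sub_smul, norm_smul, norm_eq_of_mem_sphere x, mul_one, Real.norm_eq_abs,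
        abs_of_nonneg (by linarith)]
      nlinarith
    calc dist (t • (y : EuclideanSpace ℝ (Fin 3)))
          (((⌊t / R⌋₊ : ℝ) * R) • (x : EuclideanSpace ℝ (Fin 3))) ≤ _ := dist_triangle _ _ _
      _ < R + R := add_lt_add_of_lt_of_le e1 e2
      _ = 2 * R := by ring
  have hcone : volume (Set.Ioo (0 : ℝ) 1 • ((↑) '' ball x R : Set (EuclideanSpace ℝ (Fin 3)))) ≤
      ENNReal.ofReal (16 * R ^ 2) * B := by
    refine (measure_mono hcover).trans ((measure_biUnion_finset_le _ _).trans ?_)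
    have : ∀ k ∈ Finset.range (m + 1),
        volume (ball (((k : ℝ) * R) • (x : EuclideanSpace ℝ (Fin 3))) (2 * R)) =
          ENNReal.ofReal ((2 * R) ^ 3) * B := fun k _ => by
      rw [Measure.addHaar_ball volume _ (by positivity), finrank_euclideanSpace_fin]
    rw [Finset.sum_congr rfl this, Finset.sum_const, Finset.card_range, nsmul_eq_mul, ← mul_assoc,
      ← ENNReal.ofReal_natCast, ← ENNReal.ofReal_mul (by positivity)]
    have hmR : (m : ℝ) ≤ 1 / R := Nat.floor_le (by positivity)
    rw [le_div_iff₀ hR] at hmR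
    have : ((m + 1 : ℕ) : ℝ) * (2 * R) ^ 3 ≤ 16 * R ^ 2 := by
      push_cast
      nlinarith [sq_nonneg R]
    gcongr
  rw [area, Measure.smul_apply, smul_eq_mul, Measure.toSphere_apply_univ,
    Measure.toSphere_apply' _ isOpen_ball.measurableSet, ← hB]
  have hd : ((Module.finrank ℝ (EuclideanSpace ℝ (Fin 3)) : ℕ) : ℝ≥0∞) = 3 := by
    rw [finrank_euclideanSpace_fin]; norm_num
  rw [hd]
  calc (3 * B)⁻¹ * (3 * volume (Set.Ioo (0 : ℝ) 1 •
        ((↑) '' ball x R : Set (EuclideanSpace ℝ (Fin 3)))))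
      ≤ (3 * B)⁻¹ * (3 * (ENNReal.ofReal (16 * R ^ 2) * B)) := by gcongr
    _ = ((3 * B)⁻¹ * (3 * B)) * ENNReal.ofReal (16 * R ^ 2) := by ring
    _ = ENNReal.ofReal (16 * R ^ 2) := by
      rw [ENNReal.inv_mul_cancel (by simp [hB0]) (ENNReal.mul_ne_top (by norm_num) hBt), one_mul]

/-! ### Cells of a tessellation -/

/-- The points equidistant from two different points form a set without interior. -/
lemma eq_of_eventually_geoDist_eq {p s s' : Sph}
    (h : ∀ᶠ y in nhds p, geoDist y s = geoDist y s') : s = s' := by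
  by_contra hne
  set w : EuclideanSpace ℝ (Fin 3) := (s : EuclideanSpace ℝ (Fin 3)) - s' with hw
  have hw0 : w ≠ 0 := fun h0 => hne (Subtype.ext (sub_eq_zero.1 h0))
  have horth : ∀ y : Sph, geoDist y s = geoDist y s' →
      inner ℝ (y : EuclideanSpace ℝ (Fin 3)) w = 0 := by
    intro y hy
    rw [hw, inner_sub_right, inner_eq_cos_angle, inner_eq_cos_angle, angle_eq_mul_geoDist,
      angle_eq_mul_geoDist, hy, sub_self]
  have hp : inner ℝ (p : EuclideanSpace ℝ (Fin 3)) w = 0 := horth p h.self_of_nhds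
  -- The great circle through `p` in the direction of `s - s'` leaves the bisector at once.
  set u : EuclideanSpace ℝ (Fin 3) := ‖w‖⁻¹ • w with hu
  have hu1 : ‖u‖ = 1 := norm_smul_inv_norm (𝕜 := ℝ) hw0
  have hpu : inner ℝ (p : EuclideanSpace ℝ (Fin 3)) u = 0 := by
    rw [hu, inner_smul_right, hp, mul_zero]
  have hnorm : ∀ ε : ℝ, Real.cos ε • (p : EuclideanSpace ℝ (Fin 3)) + Real.sin ε • u ∈
      sphere (0 : EuclideanSpace ℝ (Fin 3)) 1 := by
    intro ε
    rw [mem_sphere_zero_iff_norm, ← sq_eq_sq₀ (norm_nonneg _) zero_le_one, norm_add_sq_real,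
      inner_smul_left, inner_smul_right, hpu, norm_smul, norm_smul, hu1, norm_eq_of_mem_sphere p]
    simp
  set γ : ℝ → Sph := fun ε => ⟨_, hnorm ε⟩ with hγ
  have hcont : Continuous γ := Continuous.subtype_mk (by fun_prop) _
  have hγ0 : γ 0 = p := Subtype.ext (by simp [hγ])
  have hev : ∀ᶠ ε in nhds (0 : ℝ), Real.sin ε = 0 := by
    have ht : Filter.Tendsto γ (nhds 0) (nhds p) := hγ0 ▸ hcont.tendsto 0
    filter_upwards [ht.eventually h] with ε hε
    have := horth _ hε
    simp only [hγ, inner_add_left, inner_smul_left, hp, hu, real_inner_self_eq_norm_sq] at this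
    simpa [hw0] using this
  obtain ⟨δ, hδ, hball⟩ := Metric.eventually_nhds_iff.1 hev
  set ε := min (δ / 2) 1 with hε
  have hε0 : 0 < ε := lt_min (by linarith) one_pos
  have hεδ : ε < δ := (min_le_left _ _).trans_lt (by linarith)
  have hεπ : ε < Real.pi := (min_le_right _ _).trans_lt (by linarith [Real.pi_gt_three])
  refine (Real.sin_pos_of_pos_of_lt_pi hε0 hεπ).ne' (hball ?_)
  rwa [Real.dist_eq, sub_zero, abs_of_pos hε0]

lemma ball_subset_disk (p : Sph) (r : ℝ) : ball p (2 * r) ⊆ disk p r := by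
  intro y hy
  have h := two_mul_geoDist_le_dist p y
  rw [mem_ball'] at hy
  show geoDist p y ≤ r
  linarith

namespace Tessellation

variable {r : ℝ} (V : Tessellation r)

lemma dist_le_of_mem_cell {c : Fin V.count} {x y : Sph} (hx : x ∈ V.cell c) (hy : y ∈ V.cell c) :
    dist x y ≤ 16 * r := by
  obtain ⟨p, hp⟩ := V.outer_disk c
  have h1 : geoDist p x ≤ 2 * r := hp hx
  have h2 : geoDist p y ≤ 2 * r := hp hy
  have h3 := dist_triangle_left x y p
  linarith [dist_le_four_mul_geoDist p x, dist_le_four_mul_geoDist p y]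

/-- Inner points of different cells are `2 r` apart, since otherwise two cells would have a common
interior point. -/
lemma exists_separated_points (hr : 0 < r) : ∃ p : Fin V.count → Sph,
    (∀ c, p c ∈ V.cell c) ∧ ∀ c c', c ≠ c' → 2 * r ≤ dist (p c) (p c') := by
  choose p hp using V.inner_disk
  have hball : ∀ c, ball (p c) (2 * r) ⊆ V.cell c := fun c => (ball_subset_disk _ _).trans (hp c)
  refine ⟨p, fun c => hball c (mem_ball_self (by linarith)), fun c c' hne => ?_⟩
  by_contra! hlt
  refine hne (V.site_injective (eq_of_eventually_geoDist_eq (p := p c) ?_))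
  filter_upwards [isOpen_ball.mem_nhds (mem_ball_self (x := p c) (by linarith : 0 < 2 * r)),
    isOpen_ball.mem_nhds (hlt : p c ∈ ball (p c') (2 * r))] with y h1 h2
  exact le_antisymm (hball c h1 c') (hball c' h2 c)

lemma count_le (hr : 0 < r) (hr1 : r ≤ 1) : (V.count : ℝ) ≤ 8 / r ^ 2 := by
  obtain ⟨p, -, hsep⟩ := V.exists_separated_points hr
  -- The balls around the inner points lie in the shell between the radii `1 - r` and `1 + r`.
  have h := sum_radius_cube_le (Finset.univ : Finset (Option (Fin V.count)))
    (fun o => o.elim 0 fun c => (p c : EuclideanSpace ℝ (Fin 3)))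
    (fun o => o.elim (1 - r) fun _ => r) 0 (R := 1 + r)
    (by rintro (_ | c) -
        · simpa using hr1
        · exact hr.le) (by linarith)
    (by rintro (_ | c) - (_ | c') - hne
        · exact absurd rfl hne
        · simp
        · simp
        · have := hsep c c' (fun h => hne (by rw [h]))
          simp only [Option.elim_some]
          rw [Subtype.dist_eq] at this
          linarith)
    (by rintro (_ | c) -
        · simp; linarith
        · simp)
  rw [Fintype.sum_option] at h
  simp only [Option.elim_none, Option.elim_some, Finset.sum_const, Finset.card_univ,
    Fintype.card_fin, nsmul_eq_mul] at h
  rw [le_div_iff₀ (by positivity)]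
  refine le_of_mul_le_mul_right ?_ hr
  nlinarith [mul_pos hr hr, mul_nonneg (mul_nonneg hr.le hr.le) (sub_nonneg.2 hr1)]

/-- At most `18 ^ 3` cells come within (chordal) distance `r` of a given point. -/
lemma card_le_of_dist_le (hr : 0 < r) (s : Finset (Fin V.count)) (z : Sph)
    (hs : ∀ c ∈ s, ∃ x ∈ V.cell c, dist x z ≤ r) : s.card ≤ 18 ^ 3 := by
  obtain ⟨p, hmem, hsep⟩ := V.exists_separated_points hr
  have h := sum_radius_cube_le s (fun c => (p c : EuclideanSpace ℝ (Fin 3))) (fun _ => r)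
    z (R := 18 * r) (fun _ _ => hr.le) (by linarith)
    (fun c _ c' _ hne => by
      have := hsep c c' hne
      rw [Subtype.dist_eq] at this
      linarith)
    (fun c hc => by
      obtain ⟨x, hx, hxz⟩ := hs c hc
      have h1 := V.dist_le_of_mem_cell (hmem c) hx
      have h2 := dist_triangle (p c) x z
      rw [← Subtype.dist_eq]
      linarith)
  rw [Finset.sum_const, nsmul_eq_mul, mul_pow] at h
  exact_mod_cast le_of_mul_le_mul_right h (by positivity)

end Tessellation

/-! ### Interference along a route -/

/-- A link of length at least `δ` with an interferer at distance at most `D` from the receiver. -/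
lemma sinr_le {n : ℕ} {α : ℝ} (hα : 0 < α) {P : ℝ≥0} (hP : 0 < P) (N : ℝ≥0) {x : Fin n → Sph}
    {T : Finset (Fin n)} {u v k : Fin n} (hk : k ∈ T) (hku : k ≠ u) {δ D : ℝ} (hδ : 0 < δ)
    (hD : 0 < D) (huv : δ ≤ geoDist (x u) (x v)) (hkv : geoDist (x k) (x v) ≤ D) :
    sinr α P N x T u v ≤ ENNReal.ofReal (D / δ) ^ α := by
  have hP0 : (P : ℝ≥0∞) ≠ 0 := by simpa using hP.ne'
  have hpos : ∀ {t : ℝ}, 0 < t → ENNReal.ofReal t ^ α ≠ 0 := fun ht =>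
    (ENNReal.rpow_pos (ENNReal.ofReal_pos.2 ht) ENNReal.ofReal_ne_top).ne'
  have hfin : ∀ t : ℝ, ENNReal.ofReal t ^ α ≠ ∞ := fun t =>
    ENNReal.rpow_ne_top_of_nonneg hα.le ENNReal.ofReal_ne_top
  have h1 : receivedPower α P (x u) (x v) ≤ P / ENNReal.ofReal δ ^ α := by
    unfold receivedPower
    gcongr
  have h2 : (P : ℝ≥0∞) / ENNReal.ofReal D ^ α ≤
      (N : ℝ≥0∞) + ∑ k ∈ T.erase u, receivedPower α P (x k) (x v) := by
    calc (P : ℝ≥0∞) / ENNReal.ofReal D ^ α ≤ receivedPower α P (x k) (x v) := by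
          unfold receivedPower
          gcongr
      _ ≤ ∑ k ∈ T.erase u, receivedPower α P (x k) (x v) :=
          Finset.single_le_sum (f := fun k => receivedPower α P (x k) (x v))
            (fun _ _ => zero_le) (Finset.mem_erase.2 ⟨hku, hk⟩)
      _ ≤ _ := le_add_self
  calc sinr α P N x T u v
      ≤ (P / ENNReal.ofReal δ ^ α) / (P / ENNReal.ofReal D ^ α) := ENNReal.div_le_div h1 h2
    _ = ENNReal.ofReal (D / δ) ^ α := by
      rw [ENNReal.ofReal_div_of_pos hδ, ENNReal.div_rpow_of_nonneg _ _ hα.le]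
      have hD0 := hpos hD
      have hDt := hfin D
      have hδ0 := hpos hδ
      have hδt := hfin δ
      generalize ENNReal.ofReal D ^ α = y at *
      generalize ENNReal.ofReal δ ^ α = z at *
      rw [div_eq_mul_inv ((P : ℝ≥0∞) / z), ENNReal.inv_div (Or.inl hDt) (Or.inl hD0),
        div_eq_mul_inv, div_eq_mul_inv, div_eq_mul_inv,
        show (P : ℝ≥0∞) * z⁻¹ * (y * (P : ℝ≥0∞)⁻¹) = (P * (P : ℝ≥0∞)⁻¹) * (y * z⁻¹) by ring,
        ENNReal.mul_inv_cancel hP0 ENNReal.coe_ne_top, one_mul]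

/-- If every block of `M` consecutive factors has one that is at most `b`, the product of `H`
factors decays like `b ^ (H / M)`. -/
lemma prod_range_le_pow {f : ℕ → ℝ≥0∞} {b : ℝ≥0∞} {M H : ℕ} (hf : ∀ j, f j ≤ 1)
    (hb : ∀ a, a + M ≤ H → ∃ j, a ≤ j ∧ j < a + M ∧ f j ≤ b) :
    ∏ j ∈ Finset.range H, f j ≤ b ^ (H / M) := by
  have hblock : ∀ k, k * M ≤ H → ∏ j ∈ Finset.range (k * M), f j ≤ b ^ k := by
    intro k
    induction k with
    | zero => simp
    | succ k ih =>
      intro hk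
      rw [Nat.succ_mul] at hk ⊢
      obtain ⟨j, haj, hjM, hj⟩ := hb (k * M) hk
      rw [← Finset.prod_range_mul_prod_Ico _ (Nat.le_add_right (k * M) M), pow_succ]
      have : ∏ j ∈ Finset.Ico (k * M) (k * M + M), f j ≤ f j := by
        rw [← Finset.mul_prod_erase _ _ (Finset.mem_Ico.2 ⟨haj, hjM⟩)]
        exact mul_le_of_le_one_right' (Finset.prod_le_one' fun i _ => hf i)
      exact mul_le_mul' (ih (by omega)) (this.trans hj)
  refine le_trans ?_ (hblock (H / M) (Nat.div_mul_le_self H M))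
  rw [← Finset.prod_range_mul_prod_Ico _ (Nat.div_mul_le_self H M)]
  exact mul_le_of_le_one_right' (Finset.prod_le_one' fun i _ => hf i)

lemma IsLinkModel.le_one {φ : ℝ≥0∞ → ℝ≥0∞} (hφ : IsLinkModel φ) (s : ℝ≥0∞) : φ s ≤ 1 :=
  hφ.top ▸ hφ.monotone le_top

/-- A number of nodes of a route that cannot all lie within (chordal) distance `r` of one of them:
it exceeds the number `18 ^ 3` of cells that can come that close to a point. -/
def longBlock : ℕ := 18 ^ 3 + 1

/-- A number of consecutive hops among which one suffers from interference. -/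
def interferedBlock (K : ℕ) : ℕ := (K + 1) * longBlock

lemma interferedBlock_pos (K : ℕ) : 0 < interferedBlock K :=
  Nat.mul_pos K.succ_pos (Nat.succ_pos _)

/-- A bound on the SINR of an interfered hop: the sender is at least `r / (4 * longBlock)` away, the
interferer at most `(8 + 16 * interferedBlock K) * r`. -/
noncomputable def sinrBound (α : ℝ) (K : ℕ) : ℝ≥0∞ :=
  ENNReal.ofReal ((8 + 16 * interferedBlock K) * (4 * longBlock)) ^ α

section Route

variable {n : ℕ} {r : ℝ} {V : Tessellation r} {x : Fin n → Sph} {home : Fin n → Fin V.count}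
  {i d : Fin n} {q : Trip n}

lemma Trip.IsStraight.dist_hop_le (hq : q.IsStraight V x home i d)
    (hhome : ∀ i, x i ∈ V.cell (home i)) {j : ℕ} (hj : j < q.hops) :
    dist (x (q.node j)) (x (q.node (j + 1))) ≤ 32 * r := by
  obtain ⟨p, hp, -⟩ := hq.crossing
  obtain ⟨-, h1, h2⟩ := hp j hj
  have h3 := V.dist_le_of_mem_cell (hhome (q.node j)) h1
  have h4 := V.dist_le_of_mem_cell h2 (hhome (q.node (j + 1)))
  linarith [dist_triangle (x (q.node j)) (p j) (x (q.node (j + 1)))]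

lemma Trip.IsStraight.dist_node_le (hq : q.IsStraight V x home i d)
    (hhome : ∀ i, x i ∈ V.cell (home i)) {j k : ℕ} (hjk : j ≤ k) (hk : k ≤ q.hops) :
    dist (x (q.node j)) (x (q.node k)) ≤ 32 * r * (k - j : ℕ) := by
  refine (dist_le_Ico_sum_of_dist_le (f := fun j => x (q.node j)) (d := fun _ => 32 * r) hjk
    fun _ hlt => hq.dist_hop_le hhome (hlt.trans_le hk)).trans_eq ?_
  rw [Finset.sum_const, Nat.card_Ico, nsmul_eq_mul, mul_comm]

/-- Among `longBlock` consecutive hops, one has length at least `r / longBlock`, since otherwise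
the nodes of too many cells would be close to each other. -/
lemma Trip.IsStraight.exists_long_hop (hr : 0 < r) (hq : q.IsStraight V x home i d)
    (hhome : ∀ i, x i ∈ V.cell (home i)) {b : ℕ} (hb : b + longBlock ≤ q.hops) :
    ∃ j, b ≤ j ∧ j < b + longBlock ∧
      r / longBlock ≤ dist (x (q.node j)) (x (q.node (j + 1))) := by
  by_contra! hshort
  have hm : (0 : ℝ) < longBlock := by norm_num [longBlock]
  have hcard := V.card_le_of_dist_le hr
    ((Finset.Ico b (b + longBlock)).image fun j => home (q.node j)) (x (q.node b)) (by
      intro c hc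
      obtain ⟨j, hj, rfl⟩ := Finset.mem_image.1 hc
      obtain ⟨hbj, hjb⟩ := Finset.mem_Ico.1 hj
      refine ⟨_, hhome _, ?_⟩
      rw [dist_comm]
      refine (dist_le_Ico_sum_of_dist_le (f := fun j => x (q.node j))
        (d := fun _ => r / longBlock) hbj
        fun h1 h2 => (hshort _ h1 (h2.trans hjb)).le).trans ?_
      rw [Finset.sum_const, Nat.card_Ico, nsmul_eq_mul, ← mul_div_assoc, div_le_iff₀ hm, mul_comm]
      gcongr
      omega)
  rw [Finset.card_image_of_injOn (hq.cell_injOn.mono fun j hj => by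
    have := (Finset.mem_Ico.1 (Finset.mem_coe.1 hj)).2
    exact Set.mem_Iio.2 (by omega)), Nat.card_Ico] at hcard
  simp [longBlock] at hcard

end Route

namespace Operation

variable {n : ℕ} {r : ℝ} {V : Tessellation r} {K : ℕ} {x : Fin n → Sph} {dest : Fin n → Fin n}
  (O : Operation V K x dest)

/-- A block of `interferedBlock K` hops has `K + 1` long ones, hence two that take place in the same
phase of the schedule. When the earlier one takes place, the cell of the later one, which
is not empty, is scheduled as well, so that one of its nodes interferes. -/
lemma exists_sinr_le {α : ℝ} (hα : 0 < α) {P : ℝ≥0} (hP : 0 < P) (N : ℝ≥0) (hr : 0 < r)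
    {i : Fin n} {t : ℕ} (ht : t ∈ O.injects i) {q : Trip n} (hq : O.trip i t = some q) {a : ℕ}
    (ha : a + interferedBlock K ≤ q.hops) :
    ∃ j, a ≤ j ∧ j < a + interferedBlock K ∧
      sinr α P N x (O.transmits (q.slot j)) (q.node j) (q.node (j + 1)) ≤ sinrBound α K := by
  have hs := O.straight i t ht q hq
  have hlong : ∀ b ∈ Finset.range (K + 1), ∃ j, a + b * longBlock ≤ j ∧
      j < a + b * longBlock + longBlock ∧
      r / longBlock ≤ dist (x (q.node j)) (x (q.node (j + 1))) := by
    intro b hb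
    refine hs.exists_long_hop hr O.home_mem (le_trans ?_ ha)
    have : (b + 1) * longBlock ≤ interferedBlock K :=
      Nat.mul_le_mul_right _ (Finset.mem_range.1 hb)
    rw [Nat.succ_mul] at this
    omega
  choose! f hf1 hf2 hf3 using hlong
  have hfK : ∀ b ∈ Finset.range (K + 1), f b < a + interferedBlock K := by
    intro b hb
    have : (b + 1) * longBlock ≤ interferedBlock K :=
      Nat.mul_le_mul_right _ (Finset.mem_range.1 hb)
    rw [Nat.succ_mul] at this
    linarith [hf2 b hb]
  obtain ⟨b, hb, b', hb', hbb', hmod⟩ : ∃ b ∈ Finset.range (K + 1), ∃ b' ∈ Finset.range (K + 1),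
      b < b' ∧ q.slot (f b) % O.sched.period = q.slot (f b') % O.sched.period := by
    obtain ⟨b, hb, b', hb', hne, he⟩ := Finset.exists_ne_map_eq_of_card_lt_of_maps_to
      (s := Finset.range (K + 1)) (t := Finset.range O.sched.period)
      (by simpa using Nat.lt_succ_of_le O.sched.period_le)
      (f := fun b => q.slot (f b) % O.sched.period)
      (fun b _ => by simpa using Nat.mod_lt _ O.sched.period_pos)
    rcases hne.lt_or_gt with h | h
    · exact ⟨b, hb, b', hb', h, he⟩
    · exact ⟨b', hb', b, hb, h, he.symm⟩
  have hlt : f b < f b' := by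
    have : (b + 1) * longBlock ≤ b' * longBlock := Nat.mul_le_mul_right _ hbb'
    rw [Nat.succ_mul] at this
    linarith [hf2 b hb, hf1 b' hb']
  have hb'hops : f b' < q.hops := (hfK b' hb').trans_le ha
  have hactive : ∀ s, O.sched.active (s % O.sched.period) = O.sched.active s := fun s =>
    Function.Periodic.map_mod_nat O.sched.periodic s
  have hmem : O.home (q.node (f b')) ∈ O.sched.active (q.slot (f b)) := by
    rw [← hactive, hmod, hactive]
    exact O.active_of_transmits _ _ (O.transmits_hop i t ht q hq _ hb'hops)
  obtain ⟨k, ⟨hk, hkhome⟩, -⟩ := O.one_per_cell _ _ hmem ⟨_, rfl⟩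
  have hku : k ≠ q.node (f b) := by
    rintro rfl
    exact hlt.ne (hs.cell_injOn (hlt.trans hb'hops) hb'hops hkhome)
  refine ⟨f b, (Nat.le_add_right _ _).trans (hf1 b hb), hfK b hb, ?_⟩
  have hL : (0 : ℝ) < longBlock := by norm_num [longBlock]
  have hδ : r / longBlock / 4 ≤ geoDist (x (q.node (f b))) (x (q.node (f b + 1))) := by
    linarith [hf3 b hb, dist_le_four_mul_geoDist (x (q.node (f b))) (x (q.node (f b + 1)))]
  have hD : geoDist (x k) (x (q.node (f b + 1))) ≤ (8 + 16 * interferedBlock K) * r := by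
    have h1 := two_mul_geoDist_le_dist (x k) (x (q.node (f b + 1)))
    have h2 := dist_triangle_right (x k) (x (q.node (f b + 1))) (x (q.node (f b')))
    have h3 := V.dist_le_of_mem_cell (O.home_mem k) (hkhome ▸ O.home_mem (q.node (f b')))
    have h4 := hs.dist_node_le O.home_mem hlt hb'hops.le
    have h5 : ((f b' - (f b + 1) : ℕ) : ℝ) ≤ interferedBlock K := by
      have := hfK b' hb'
      have := hf1 b hb
      exact_mod_cast (by omega : f b' - (f b + 1) ≤ interferedBlock K)
    have h6 := mul_le_mul_of_nonneg_left h5 (by positivity : (0 : ℝ) ≤ 32 * r)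
    linarith
  refine (sinr_le hα hP N hk hku (by positivity) (by positivity) hδ hD).trans_eq ?_
  rw [sinrBound]
  congr 2
  field_simp

/-- Every packet suffers a constant loss on every `interferedBlock K` hops. -/
lemma success_le_pow {φ : ℝ≥0∞ → ℝ≥0∞} (hφ : IsLinkModel φ) {α : ℝ} (hα : 0 < α) {P : ℝ≥0}
    (hP : 0 < P) (N : ℝ≥0) (hr : 0 < r) {i : Fin n} {t : ℕ} (ht : t ∈ O.injects i) {q : Trip n}
    (hq : O.trip i t = some q) :
    q.success φ α P N x O.transmits ≤ φ (sinrBound α K) ^ (q.hops / interferedBlock K) :=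
  prod_range_le_pow (fun _ => hφ.le_one _) fun _ ha =>
    let ⟨j, h1, h2, h3⟩ := O.exists_sinr_le hα hP N hr ht hq ha
    ⟨j, h1, h2, hφ.monotone h3⟩

/-! ### Injection rate and throughput of a given network -/

/-- In every slot, each cell has at most one transmitting node, and hence at most one node that
injects a packet. -/
lemma mul_rate_le : (n : ℝ) * O.rate ≤ V.count := by
  have hslot : ∀ t, ∑ i, (O.injects i).indicator (fun _ => (1 : ℝ)) t ≤ V.count := by
    intro t
    have hinj : Set.InjOn O.home (O.transmits t) := by
      intro i hi j hj hij
      obtain ⟨k, -, hk⟩ := O.one_per_cell t _ (O.active_of_transmits t i hi) ⟨i, rfl⟩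
      exact (hk i ⟨hi, rfl⟩).trans (hk j ⟨hj, hij.symm⟩).symm
    have hcard : (O.transmits t).card ≤ V.count := by
      rw [← Finset.card_image_of_injOn hinj]
      exact (Finset.card_le_univ _).trans_eq (Fintype.card_fin _)
    calc ∑ i, (O.injects i).indicator (fun _ => (1 : ℝ)) t
        ≤ ∑ i, if i ∈ O.transmits t then (1 : ℝ) else 0 := by
          refine Finset.sum_le_sum fun i _ => ?_
          by_cases hi : t ∈ O.injects i
          · simp [hi, O.transmits_of_injects i t hi]
          · rw [Set.indicator_of_notMem hi]
            positivity
      _ = (O.transmits t).card := by simp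
      _ ≤ V.count := by exact_mod_cast hcard
  have hlim : Filter.Tendsto (fun s : ℕ => ∑ i,
      (∑ t ∈ Finset.range s, (O.injects i).indicator (fun _ => (1 : ℝ)) t) / s) Filter.atTop
      (nhds (∑ _i : Fin n, O.rate)) := tendsto_finsetSum _ fun i _ => O.tendsto_rate i
  rw [Finset.sum_const, Finset.card_univ, Fintype.card_fin, nsmul_eq_mul] at hlim
  refine le_of_tendsto' hlim fun s => ?_
  rw [← Finset.sum_div, Finset.sum_comm]
  refine div_le_of_le_mul₀ s.cast_nonneg V.count.cast_nonneg ?_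
  refine (Finset.sum_le_sum fun t _ => hslot t).trans_eq ?_
  rw [Finset.sum_const, Finset.card_range, nsmul_eq_mul, mul_comm]

lemma throughput_le_rate_mul {φ : ℝ≥0∞ → ℝ≥0∞} {α : ℝ} {P N : ℝ≥0} {i : Fin n} {B : ℝ≥0∞}
    (hBt : B ≠ ∞)
    (hB : ∀ t ∈ O.injects i, ∀ q, O.trip i t = some q → q.success φ α P N x O.transmits ≤ B) :
    O.throughput φ α P N i ≤ ENNReal.ofReal O.rate * B := by
  have hterm : ∀ t, (O.injects i).indicator
      (fun t => (O.trip i t).elim 0 (Trip.success φ α P N x O.transmits)) t ≤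
      ENNReal.ofReal ((O.injects i).indicator (fun _ => (1 : ℝ)) t) * B := by
    intro t
    by_cases ht : t ∈ O.injects i
    · rw [Set.indicator_of_mem ht, Set.indicator_of_mem ht, ENNReal.ofReal_one, one_mul]
      cases hq : O.trip i t with
      | none => exact zero_le
      | some q => exact hB t ht q hq
    · rw [Set.indicator_of_notMem ht]
      exact zero_le
  have hlim : Filter.Tendsto (fun s : ℕ => ENNReal.ofReal
      ((∑ t ∈ Finset.range s, (O.injects i).indicator (fun _ => (1 : ℝ)) t) / s) * B) Filter.atTop
      (nhds (ENNReal.ofReal O.rate * B)) :=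
    ENNReal.Tendsto.mul_const (ENNReal.tendsto_ofReal (O.tendsto_rate i)) (Or.inr hBt)
  refine (Filter.limsup_le_limsup ?_).trans_eq hlim.limsup_eq
  filter_upwards [Filter.eventually_gt_atTop 0] with s hs
  have hs' : (0 : ℝ) < s := by exact_mod_cast hs
  rw [ENNReal.ofReal_div_of_pos hs', ENNReal.ofReal_natCast,
    ENNReal.ofReal_sum_of_nonneg fun t _ => Set.indicator_nonneg (fun _ _ => zero_le_one) t,
    div_eq_mul_inv, div_eq_mul_inv, mul_right_comm, Finset.sum_mul _ _ B]
  exact mul_le_mul' (Finset.sum_le_sum fun t _ => hterm t) le_rfl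

/-- The success probability decays geometrically in the distance from source to destination,
measured in cell radii, because a hop covers a distance of at most `32 r`. -/
lemma throughput_le {φ : ℝ≥0∞ → ℝ≥0∞} (hφ : IsLinkModel φ) {α : ℝ} (hα : 0 < α) {P : ℝ≥0}
    (hP : 0 < P) (N : ℝ≥0) (hr : 0 < r) (i : Fin n) :
    O.throughput φ α P N i ≤ ENNReal.ofReal O.rate * φ (sinrBound α K) ^
      ⌊dist (x i) (x (dest i)) / (32 * r * interferedBlock K)⌋₊ := by
  refine O.throughput_le_rate_mul
    (ne_top_of_le_ne_top ENNReal.one_ne_top (pow_le_one' (hφ.le_one _) _)) fun t ht q hq =>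
    (O.success_le_pow hφ hα hP N hr ht hq).trans (pow_le_pow_right_of_le_one' (hφ.le_one _) ?_)
  have hs := O.straight i t ht q hq
  have hM := interferedBlock_pos K
  have hM' : (0 : ℝ) < interferedBlock K := by exact_mod_cast hM
  have hdist := hs.dist_node_le O.home_mem (Nat.zero_le _) le_rfl
  rw [hs.source, hs.target, Nat.sub_zero] at hdist
  rw [Nat.le_div_iff_mul_le hM]
  have hfl := Nat.floor_le (a := dist (x i) (x (dest i)) / (32 * r * interferedBlock K))
    (by positivity)
  rw [le_div_iff₀ (by positivity)] at hfl
  have : (⌊dist (x i) (x (dest i)) / (32 * r * interferedBlock K)⌋₊ : ℝ) * interferedBlock K ≤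
      q.hops := le_of_mul_le_mul_left (by linarith) (by positivity : 0 < 32 * r)
  exact_mod_cast this

end Operation

/-! ### The random network -/

lemma pi_area_dist_lt_le {n : ℕ} {i j : Fin n} (hij : i ≠ j) {R : ℝ} (hR : 0 < R) :
    (Measure.pi fun _ : Fin n => area) {x | dist (x i) (x j) < R} ≤
      ENNReal.ofReal (16 * R ^ 2) := by
  have hmeas : MeasurableSet {p : Sph × Sph | dist p.1 p.2 < R} :=
    (isOpen_lt (by fun_prop) continuous_const).measurableSet
  have hmap : (Measure.pi fun _ : Fin n => area).map (fun x => (x i, x j)) = area.prod area := by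
    have h := (ProbabilityTheory.iIndepFun_pi (μ := fun _ : Fin n => area) (X := fun _ => id)
      fun _ => aemeasurable_id).indepFun hij
    have := h.map_prod_eq_prod_map_map (measurable_pi_apply i).aemeasurable
      (measurable_pi_apply j).aemeasurable
    refine this.trans ?_
    exact congrArg₂ _ (measurePreserving_eval (fun _ : Fin n => area) i).map_eq
      (measurePreserving_eval (fun _ : Fin n => area) j).map_eq
  have : {x : Fin n → Sph | dist (x i) (x j) < R} =
      (fun x => (x i, x j)) ⁻¹' {p : Sph × Sph | dist p.1 p.2 < R} := rfl
  rw [this, ← Measure.map_apply (by fun_prop) hmeas, hmap, Measure.prod_apply hmeas]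
  refine (lintegral_mono (g := fun _ => ENNReal.ofReal (16 * R ^ 2)) fun x => ?_).trans ?_
  · refine (measure_mono fun y hy => ?_).trans (area_ball_le x hR)
    exact mem_ball'.2 hy
  · simp

lemma measurableSet_dist_lt {n : ℕ} (i : Fin n) (R : ℝ) :
    MeasurableSet {ω : Config n | dist (ω.1 i) (ω.1 (ω.2 i)) < R} := by
  have : {ω : Config n | dist (ω.1 i) (ω.1 (ω.2 i)) < R} =
      ⋃ j : {j : Fin n // j ≠ i}, {ω | ω.2 i = j} ∩ {ω | dist (ω.1 i) (ω.1 j) < R} := by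
    ext ω
    simp only [Set.mem_iUnion, Set.mem_inter_iff, Set.mem_ofPred_eq]
    exact ⟨fun h => ⟨ω.2 i, rfl, h⟩, by rintro ⟨j, rfl, h⟩; exact h⟩
  rw [this]
  refine MeasurableSet.iUnion fun j => MeasurableSet.inter ?_ ?_
  · exact (measurableSet_singleton j).preimage ((measurable_pi_apply i).comp measurable_snd)
  · exact measurableSet_lt (by fun_prop) measurable_const

lemma isProbabilityMeasure_dest {n : ℕ} (hn : 2 ≤ n) : IsProbabilityMeasure
    (ProbabilityTheory.uniformOn (Set.univ : Set ((i : Fin n) → {j : Fin n // j ≠ i}))) := by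
  have : Nontrivial (Fin n) := Fin.nontrivial_iff_two_le.2 hn
  have : ∀ i : Fin n, Nonempty {j : Fin n // j ≠ i} := fun i =>
    let ⟨j, hj⟩ := exists_ne i
    ⟨⟨j, hj⟩⟩
  exact ProbabilityTheory.isProbabilityMeasure_uniformOn Set.finite_univ Set.univ_nonempty

lemma configMeasure_dist_lt_le {n : ℕ} (hn : 2 ≤ n) (i : Fin n) {R : ℝ} (hR : 0 < R) :
    configMeasure n {ω | dist (ω.1 i) (ω.1 (ω.2 i)) < R} ≤ ENNReal.ofReal (16 * R ^ 2) := by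
  have := isProbabilityMeasure_dest hn
  rw [configMeasure, Measure.prod_apply_symm (measurableSet_dist_lt i R)]
  refine (lintegral_mono (g := fun _ => ENNReal.ofReal (16 * R ^ 2)) fun d => ?_).trans ?_
  · exact pi_area_dist_lt_le (d i).2.symm hR
  · simp

/-- The mean of a geometrically decaying function of the source-destination distance is of the
order of the square of the decay length. -/
lemma lintegral_pow_floor_dist_le {n : ℕ} (hn : 2 ≤ n) (i : Fin n) {b : ℝ≥0∞}
    {ℓ : ℝ} (hℓ : 0 < ℓ) :
    ∫⁻ ω, b ^ ⌊dist (ω.1 i) (ω.1 (ω.2 i)) / ℓ⌋₊ ∂(configMeasure n) ≤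
      ENNReal.ofReal (16 * ℓ ^ 2) * ∑' k : ℕ, b ^ k * (k + 1 : ℝ≥0∞) ^ 2 := by
  set A : ℕ → Set (Config n) := fun k => {ω | dist (ω.1 i) (ω.1 (ω.2 i)) < ℓ * (k + 1)} with hA
  have hAm : ∀ k, MeasurableSet (A k) := fun k => measurableSet_dist_lt i _
  have hle : ∀ ω : Config n, b ^ ⌊dist (ω.1 i) (ω.1 (ω.2 i)) / ℓ⌋₊ ≤
      ∑' k, (A k).indicator (fun _ => b ^ k) ω := by
    intro ω
    refine le_trans ?_ (ENNReal.le_tsum ⌊dist (ω.1 i) (ω.1 (ω.2 i)) / ℓ⌋₊)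
    have : ω ∈ A ⌊dist (ω.1 i) (ω.1 (ω.2 i)) / ℓ⌋₊ := by
      have := Nat.lt_floor_add_one (dist (ω.1 i) (ω.1 (ω.2 i)) / ℓ)
      rwa [div_lt_iff₀' hℓ] at this
    rw [Set.indicator_of_mem this]
  refine (lintegral_mono hle).trans ?_
  rw [lintegral_tsum fun k => (measurable_const.indicator (hAm k)).aemeasurable,
    ← ENNReal.tsum_mul_left]
  refine ENNReal.tsum_le_tsum fun k => ?_
  rw [lintegral_indicator_const (hAm k)]
  calc b ^ k * configMeasure n (A k)
      ≤ b ^ k * ENNReal.ofReal (16 * (ℓ * (k + 1)) ^ 2) := by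
        gcongr
        exact configMeasure_dist_lt_le hn i (by positivity)
    _ = ENNReal.ofReal (16 * ℓ ^ 2) * (b ^ k * (k + 1 : ℝ≥0∞) ^ 2) := by
        rw [mul_pow, ← mul_assoc 16, ENNReal.ofReal_mul (by positivity),
          ENNReal.ofReal_pow (by positivity), ENNReal.ofReal_add (by positivity) zero_le_one,
          ENNReal.ofReal_natCast, ENNReal.ofReal_one]
        ring

lemma tsum_pow_mul_sq_ne_top {b : ℝ≥0∞} (hb : b < 1) :
    ∑' k : ℕ, b ^ k * (k + 1 : ℝ≥0∞) ^ 2 ≠ ∞ := by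
  lift b to ℝ≥0 using hb.ne_top
  have hb' : b < 1 := by exact_mod_cast hb
  have hn : ‖(b : ℝ)‖ < 1 := by simpa using hb'
  have h : Summable fun k : ℕ => (b : ℝ) ^ k * (k + 1 : ℝ) ^ 2 := by
    have h2 := summable_pow_mul_geometric_of_norm_lt_one 2 hn
    have h1 := summable_pow_mul_geometric_of_norm_lt_one 1 hn
    have h0 := summable_pow_mul_geometric_of_norm_lt_one 0 hn
    refine ((h2.add (h1.mul_left 2)).add h0).congr fun k => ?_
    ring
  have h' : Summable fun k : ℕ => b ^ k * (k + 1 : ℝ≥0) ^ 2 := by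
    rw [← NNReal.summable_coe]
    exact_mod_cast h
  have := ENNReal.tsum_coe_ne_top_iff_summable.2 h'
  exact_mod_cast this

end AdHoc

open MeasureTheory AdHoc in
theorem proposition3 (α : ℝ) (hα : 2 < α) (φ : ℝ≥0∞ → ℝ≥0∞) (hφ : AdHoc.IsLinkModel φ) (K : ℕ) :
    ∃ c : ℝ≥0, ∀ (P N : ℝ≥0), 0 < P → ∀ ρ : ℕ → ℝ, AdHoc.IsCellRadius ρ →
      ∀ᶠ n : ℕ in Filter.atTop, ∀ (V : AdHoc.Tessellation (ρ n))
        (S : (ω : AdHoc.Config n) → AdHoc.Operation V K ω.1 (fun i => (ω.2 i : Fin n)))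
        (i : Fin n),
        AdHoc.expectedThroughput S φ α P N i ≤ (c : ℝ≥0∞) / (n : ℝ≥0∞) := by
  have hα0 : 0 < α := by linarith
  set b := φ (sinrBound α K) with hb
  have hb1 : b < 1 := hφ.lt_one _ (ENNReal.rpow_ne_top_of_nonneg hα0.le ENNReal.ofReal_ne_top)
  set σ : ℝ≥0∞ := ∑' k : ℕ, b ^ k * (k + 1 : ℝ≥0∞) ^ 2 with hσ
  have hσt : σ ≠ ∞ := tsum_pow_mul_sq_ne_top hb1
  have hM : (0 : ℝ) < interferedBlock K := by
    exact_mod_cast interferedBlock_pos K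
  set C : ℝ≥0∞ := ENNReal.ofReal (8 * (16 * (32 * interferedBlock K) ^ 2)) * σ with hC
  have hCt : C ≠ ∞ := ENNReal.mul_ne_top ENNReal.ofReal_ne_top hσt
  refine ⟨C.toNNReal, fun P N hP ρ hρ => ?_⟩
  obtain ⟨a, ha, hlow⟩ := hρ.lower
  filter_upwards [hlow, hρ.tendsto_zero.eventually_le_const one_pos,
    Filter.eventually_ge_atTop 2] with n hn hr1 hn2 V S i
  have hn0 : (0 : ℝ) < n := by positivity
  have hr : 0 < ρ n := by
    refine lt_of_lt_of_le ?_ hn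
    have : 0 < Real.log n := Real.log_pos (by exact_mod_cast hn2)
    positivity
  have hrate : ∀ ω, (S ω).rate ≤ 8 / ρ n ^ 2 / n := fun ω => by
    rw [le_div_iff₀' hn0]
    exact (S ω).mul_rate_le.trans (V.count_le hr hr1)
  rw [ENNReal.coe_toNNReal hCt, expectedThroughput]
  calc ∫⁻ ω, (S ω).throughput φ α P N i ∂(configMeasure n)
      ≤ ∫⁻ ω, ENNReal.ofReal (8 / ρ n ^ 2 / n) *
          b ^ ⌊dist (ω.1 i) (ω.1 (ω.2 i)) / (32 * ρ n * interferedBlock K)⌋₊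
            ∂(configMeasure n) := by
        refine lintegral_mono fun ω => ((S ω).throughput_le hφ hα0 hP N hr i).trans ?_
        gcongr
        exact hrate ω
    _ ≤ ENNReal.ofReal (8 / ρ n ^ 2 / n) *
          (ENNReal.ofReal (16 * (32 * ρ n * interferedBlock K) ^ 2) * σ) := by
        rw [lintegral_const_mul' _ _ ENNReal.ofReal_ne_top]
        gcongr
        exact lintegral_pow_floor_dist_le hn2 i (by positivity)
    _ = C / n := by
        rw [hC, ← mul_assoc, ← ENNReal.ofReal_mul (by positivity), ENNReal.mul_div_right_comm,
          ← ENNReal.ofReal_natCast n, ← ENNReal.ofReal_div_of_pos hn0]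
        congr 2
        field_simp
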